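/- **Setting.** Let $\Omega=\{\omega_1,\dots,\omega_T\}$ ($T\ge 1$) carry the uniform probability, let $N\ge 1$, and let prospects be the elements $X=(X_n(\omega_t))_{t,n}$ of $\mathbb R^{TN}$ with the sup norm. Let $W_0$ and $(W_k,Y_k)$, $k=1,\dots,K$ ($K\ge 0$), be prospects and $C>0$. Let $\mathscr R_L(\mathcal E)$ be the set of all $\phi:\mathbb R^{TN}\to\mathbb R$ that are upper semicontinuous, monotone for the componentwise order, quasi-concave and law invariant ($\phi(X)=\phi(Y)$ if $X,Y$ have the same distribution), with $\phi(W_0)=0$, $|\phi(X)-\phi(Y)|\le C\|X-Y\|_\infty$ for all $X,Y$, and $\phi(W_k)\ge\phi(Y_k)$ for all $k$. Put $\psi(X)=\inf_{\phi\in\mathscr R_L(\mathcal E)}\phi(X)$. Let $J=2K+1$, let $\Theta$ be the family $W_0,W_1,Y_1,\dots,W_K,Y_K$, and for a permutation $\sigma$ of $\{1,\dots,T\}$ put $\sigma(X)=(X(\omega_{\sigma(t)}))_t$. Let $\Theta_L$ be the set of all $\sigma(\theta)$, $\theta\in\Theta$. Let $v^*$ be an optimal solution of the value problem: minimize $\sum_{\theta\in\Theta_L}v_\theta$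 over $v_\theta\in\mathbb R$, $s_\theta\in\mathbb R^{TN}$ ($\theta\in\Theta_L$) subject to $v_\theta+\max\{\langle s_\theta,\theta'-\theta\rangle,0\}\ge v_{\theta'}$ for $\theta\ne\theta'$ in $\Theta_L$; $s_\theta\ge 0$, $\|s_\theta\|_1\le C$; $v_{\sigma(W_k)}\ge v_{\sigma'(Y_k)}$ for all $k,\sigma,\sigma'$; $v_{\sigma(W_0)}=0$ for all $\sigma$. List $\Theta$ as $\theta_1,\dots,\theta_J$ with $v^*_{\theta_1}\ge\dots\ge v^*_{\theta_J}$, in any such order, and write $v^*_j=v^*_{\theta_j}$, $v^*_{J+1}=-\infty$, $\mathcal D_{L,j}=(\theta_1,\dots,\theta_j)$. For $1\le h\le J$ let $\kappa(h)$ be the largest index $j\le J$ with $v^*_j=v^*_h$ (so $\kappa(h)=h$ if $v^*_{h+1}<v^*_h$). Let $\mathcal Z\subset\mathbb R^M$ be nonempty, compact and convex, and let $G:\mathcal Z\to\mathbb R^{TN}$ be componentwise concave. For each $j$ consider the constraints, in $z\in\mathcal Z$, $v\in\mathbb R$, $p\in\mathbb R^j_{\ge0}$, $q\ge 0$, $\rho_\theta\in\mathbb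 R^{T\times T}_{\ge 0}$ ($\theta\in\mathcal D_{L,j}$), $$v^*_{j+1}<v\le v^*_j,\quad \sum_{\theta\in\mathcal D_{L,j}}v^*_\theta p_\theta-Cq\ge v,\quad \sum_{\theta\in\mathcal D_{L,j}}\rho_\theta^{\top}\theta_n-G_n(z)\le q\mathbf 1_T\ (1\le n\le N),$$ $$\sum_{\theta\in\mathcal D_{L,j}}p_\theta=1,\quad \mathbf 1_T^\top\rho_\theta=p_\theta\mathbf 1_T^\top,\quad \rho_\theta\mathbf 1_T=p_\theta\mathbf 1_T .$$ $\mathscr F_L(\mathcal D_{L,j})$ asks whether they can be satisfied; $\mathscr G_L(\mathcal D_{L,j})$ maximizes $v$ subject to them. **Binary search over levels.** Start with $h_1=J+1$, $h_2=0$. While $h_1\ne h_2+1$, put $h=\lceil (h_1+h_2)/2\rceil$, solve $\mathscr F_L(\mathcal D_{L,\kappa(h)})$, and set $h_1:=h$ if it is feasible, $h_2:=h$ if not. Finally put $h=\lceil (h_1+h_2)/2\rceil$, take any optimal solution of $\mathscr G_L(\mathcal D_{L,\kappa(h)})$, and output its components $z$ and $v$. **Theorem.** The constraint sets of all these problems are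 convex, so $\mathscr G_L(\mathcal D_{L,j})$ is a convex program. Every run of the binary search that reaches an output $(z^*,v)$ solves at most $\lfloor\log_2 J\rfloor+1=O(\log J)$ feasibility problems $\mathscr F_L(\mathcal D_{L,j})$ and exactly one problem $\mathscr G_L(\mathcal D_{L,j})$; moreover $z^*$ is an optimal solution of $\max_{z\in\mathcal Z}\psi(G(z))$, and $v=\psi(G(z^*))$. Conversely, every optimal solution of $\max_{z\in\mathcal Z}\psi(G(z))$ is the output of some run; in particular, if the maximum is attained, some run reaches an output. This is the case whenever all functions $z\mapsto G_n(z,\omega_t)$ are upper semicontinuous on $\mathcal Z$. -/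

import Mathlib

open Set MeasureTheory ProbabilityTheory Matrix

noncomputable section

namespace PRO

/-! ### Prospects and choice functions -/

/-- Prospects with `N` attributes on `T` scenarios; the norm of this type is the sup norm. -/
abbrev Prospect (T N : ℕ) : Type := Fin T → Fin N → ℝ

/-- The inner product of `ℝ^{TN}`. -/
def pairing {T N : ℕ} (s X : Prospect T N) : ℝ := ∑ t, ∑ n, s t n * X t n

/-- The `ℓ¹` norm of `ℝ^{TN}`. -/
def oneNorm {T N : ℕ} (s : Prospect T N) : ℝ := ∑ t, ∑ n, |s t n|

/-- `σ(X)`: scenario `t` receives the outcome `X (σ t)`. -/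
def permute {T N : ℕ} (σ : Equiv.Perm (Fin T)) (X : Prospect T N) : Prospect T N :=
  fun t => X (σ t)

/-- The reference probability on the scenarios: weight `1 / T` on each of them. -/
def refProb (T : ℕ) : Measure (Fin T) := uniformOn Set.univ

/-- Quasi-concavity. -/
def QCo {T N : ℕ} (φ : Prospect T N → ℝ) : Prop :=
  ∀ X Y : Prospect T N, ∀ l : ℝ, 0 ≤ l → l ≤ 1 → min (φ X) (φ Y) ≤ φ (l • X + (1 - l) • Y)

/-- Lipschitz continuity with modulus `C` in the sup norm. -/
def Lip {T N : ℕ} (C : ℝ) (φ : Prospect T N → ℝ) : Prop :=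
  ∀ X Y : Prospect T N, |φ X - φ Y| ≤ C * ‖X - Y‖

/-- Law invariance: prospects that are equal in distribution have the same value. -/
def LawInvariant {T N : ℕ} (φ : Prospect T N → ℝ) : Prop :=
  ∀ X Y : Prospect T N, IdentDistrib X Y (refProb T) (refProb T) → φ X = φ Y

/-- The data of the robust choice model: the normalizing prospect `W₀`, the Lipschitz modulus `C`
and the elicited comparisons, `W k` being weakly preferred to `Y k`. -/
structure Model (T N K : ℕ) where
  W₀ : Prospect T N
  W : Fin K → Prospect T N
  Y : Fin K → Prospect T N
  C : ℝ

/-- Labels for the `2 * K + 1` prospects `W₀, W₁, Y₁, …, W_K, Y_K`. -/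
abbrev Label (K : ℕ) : Type := Option (Fin K ⊕ Fin K)

namespace Model

variable {T N K : ℕ} (D : Model T N K)

/-- The prospects of `Θ`, as a family. -/
def prospect : Label K → Prospect T N
  | none => D.W₀
  | some (Sum.inl k) => D.W k
  | some (Sum.inr k) => D.Y k

/-- The law invariant ambiguity set. -/
def lawAmbiguitySet : Set (Prospect T N → ℝ) :=
  {φ | UpperSemicontinuous φ ∧ Monotone φ ∧ QCo φ ∧ φ D.W₀ = 0 ∧ Lip D.C φ ∧ LawInvariant φ ∧
    ∀ k, φ (D.Y k) ≤ φ (D.W k)}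

/-- The law invariant robust choice function: the worst case over the ambiguity set. -/
def lawRCF (X : Prospect T N) : ℝ := ⨅ φ : D.lawAmbiguitySet, (φ : Prospect T N → ℝ) X

/-! ### The law invariant value problem -/

open Classical in
/-- The augmented support set `Θ_L`: all permutations of the prospects of `Θ`. -/
def thetaL : Finset (Prospect T N) :=
  Finset.univ.image fun a : Equiv.Perm (Fin T) × Label K => permute a.1 (D.prospect a.2)

/-- The constraints of the law invariant value problem. Only the entries of `v` and `s` at the
points of `Θ_L` are decision variables. -/
def ValueFeasible (v : Prospect T N → ℝ) (s : Prospect T N → Prospect T N) : Prop :=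
  (∀ θ ∈ D.thetaL, ∀ θ' ∈ D.thetaL, θ ≠ θ' →
    v θ' ≤ v θ + max (pairing (s θ) (θ' - θ)) 0) ∧
  (∀ θ ∈ D.thetaL, 0 ≤ s θ ∧ oneNorm (s θ) ≤ D.C) ∧
  (∀ k, ∀ σ σ' : Equiv.Perm (Fin T), v (permute σ' (D.Y k)) ≤ v (permute σ (D.W k))) ∧
  (∀ σ : Equiv.Perm (Fin T), v (permute σ D.W₀) = 0)

/-- `v` is an optimal solution of the law invariant value problem, which minimizes the sum of the
values over `Θ_L`. -/
def IsValueSolution (v : Prospect T N → ℝ) : Prop :=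
  (∃ s, D.ValueFeasible v s) ∧
    ∀ v' s', D.ValueFeasible v' s' → ∑ θ ∈ D.thetaL, v θ ≤ ∑ θ ∈ D.thetaL, v' θ

/-! ### Decompositions and levels -/

/-- `e` lists the prospects of `Θ` in the order of non-increasing values. The list positions
`0, …, 2 * K` of `Fin (2 * K + 1)` stand for the indices `1, …, J`, where `J = 2 * K + 1`. -/
def IsDecomposition (v : Prospect T N → ℝ) (e : Fin (2 * K + 1) ≃ Label K) : Prop :=
  Antitone fun i => v (D.prospect (e i))

/-- The value of the `j`-th prospect of the list for `1 ≤ j ≤ J`, and `-∞` for `j = J + 1`. -/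
def level (v : Prospect T N → ℝ) (e : Fin (2 * K + 1) ≃ Label K) (j : ℕ) : EReal :=
  if h : 1 ≤ j ∧ j ≤ 2 * K + 1 then
    ((v (D.prospect (e ⟨j - 1, by omega⟩)) : ℝ) : EReal)
  else ⊥

open Classical in
/-- Level selection: the largest index whose value is at least `u`, that is, the only
`j` with `level (j + 1) < u ≤ level j`. -/
def kappa (v : Prospect T N → ℝ) (e : Fin (2 * K + 1) ≃ Label K) (u : EReal) : ℕ :=
  Nat.findGreatest (fun j => u ≤ D.level v e j) (2 * K + 1)

end Model

/-- The positions of the first `j` prospects of the list. -/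
abbrev Pos (K j : ℕ) : Type := {i : Fin (2 * K + 1) // (i : ℕ) < j}

/-- The decision variables `(z, v, p, q, ρ)` of the `j`-th feasibility and optimization problem. -/
abbrev Var (M T K j : ℕ) : Type :=
  (Fin M → ℝ) × ℝ × (Pos K j → ℝ) × ℝ × (Pos K j → Matrix (Fin T) (Fin T) ℝ)

namespace Model

variable {T N K M : ℕ} (D : Model T N K)

/-- The common constraints of the `j`-th feasibility problem and the `j`-th optimization problem;
`vs` holds the values of the prospects. -/
def LevelConstraints (Z : Set (Fin M → ℝ)) (G : (Fin M → ℝ) → Prospect T N)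
    (vs : Prospect T N → ℝ) (e : Fin (2 * K + 1) ≃ Label K) (j : ℕ)
    (z : Fin M → ℝ) (v : ℝ) (p : Pos K j → ℝ) (q : ℝ)
    (ρ : Pos K j → Matrix (Fin T) (Fin T) ℝ) : Prop :=
  z ∈ Z ∧ D.level vs e (j + 1) < (v : EReal) ∧ (v : EReal) ≤ D.level vs e j ∧
  v ≤ ∑ i, vs (D.prospect (e i.1)) * p i - D.C * q ∧
  (∀ n t, ∑ i, ((ρ i)ᵀ *ᵥ fun t' => D.prospect (e i.1) t' n) t - G z t n ≤ q) ∧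
  ∑ i, p i = 1 ∧ (∀ i, 0 ≤ p i) ∧ 0 ≤ q ∧
  (∀ i, (1 : Fin T → ℝ) ᵥ* ρ i = (fun _ => p i) ∧ ρ i *ᵥ (1 : Fin T → ℝ) = (fun _ => p i) ∧
    ∀ t t', 0 ≤ ρ i t t')

/-- The set of feasible points of the `j`-th feasibility (or optimization) problem. -/
def levelSet (Z : Set (Fin M → ℝ)) (G : (Fin M → ℝ) → Prospect T N)
    (vs : Prospect T N → ℝ) (e : Fin (2 * K + 1) ≃ Label K) (j : ℕ) : Set (Var M T K j) :=
  {x | D.LevelConstraints Z G vs e j x.1 x.2.1 x.2.2.1 x.2.2.2.1 x.2.2.2.2}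

/-- The `j`-th feasibility problem `F_L(D_{L,j})` has a solution. -/
def FeasibleF (Z : Set (Fin M → ℝ)) (G : (Fin M → ℝ) → Prospect T N)
    (vs : Prospect T N → ℝ) (e : Fin (2 * K + 1) ≃ Label K) (j : ℕ) : Prop :=
  (D.levelSet Z G vs e j).Nonempty

/-- `(z, v)` is the `(z, v)`-part of an optimal solution of the `j`-th optimization problem
`G_L(D_{L,j})`, which maximizes `v`. -/
def OptimalG (Z : Set (Fin M → ℝ)) (G : (Fin M → ℝ) → Prospect T N)
    (vs : Prospect T N → ℝ) (e : Fin (2 * K + 1) ≃ Label K) (j : ℕ)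
    (r : (Fin M → ℝ) × ℝ) : Prop :=
  ∃ x ∈ D.levelSet Z G vs e j, (∀ y ∈ D.levelSet Z G vs e j, y.2.1 ≤ x.2.1) ∧
    r = (x.1, x.2.1)

/-- `z` is an optimal solution of the law invariant preference robust optimization problem. -/
def IsPROSolution (Z : Set (Fin M → ℝ)) (G : (Fin M → ℝ) → Prospect T N)
    (z : Fin M → ℝ) : Prop :=
  z ∈ Z ∧ ∀ z' ∈ Z, D.lawRCF (G z') ≤ D.lawRCF (G z)

end Model

/-! ### Procedures that call solvers, and binary search -/

/-- Procedures that may ask whether the `j`-th feasibility problem is feasible and branch on the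
answer, ask for an optimal solution of the `j`-th optimization problem and go on with it, and
output a result. -/
inductive Procedure (α : Type) : Type where
  | output (r : α) : Procedure α
  | test (j : ℕ) (ifFeasible ifInfeasible : Procedure α) : Procedure α
  | optimize (j : ℕ) (next : α → Procedure α) : Procedure α

/-- `Runs F O P a b r`: some run of `P` solves exactly `a` feasibility problems and `b` optimization
problems and outputs `r`. Here `F j` says that the `j`-th feasibility problem is feasible and `O j x`
that `x` is an optimal solution of the `j`-th optimization problem; any such `x` may be returned by
the solver, and a run gets stuck if there is none. -/
inductive Runs {α : Type} (F : ℕ → Prop) (O : ℕ → α → Prop) :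
    Procedure α → ℕ → ℕ → α → Prop where
  | output (r : α) : Runs F O (.output r) 0 0 r
  | feasible {j : ℕ} {P Q : Procedure α} {a b : ℕ} {r : α} (hF : F j) (h : Runs F O P a b r) :
      Runs F O (.test j P Q) (a + 1) b r
  | infeasible {j : ℕ} {P Q : Procedure α} {a b : ℕ} {r : α} (hF : ¬ F j)
      (h : Runs F O Q a b r) : Runs F O (.test j P Q) (a + 1) b r
  | optimize {j : ℕ} {next : α → Procedure α} {x : α} {a b : ℕ} {r : α} (hO : O j x)
      (h : Runs F O (next x) a b r) : Runs F O (.optimize j next) a (b + 1) r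

/-- Binary search between `h₂` and `h₁`, where `h₂ < h₁`: as long as `h₁ ≠ h₂ + 1`, put
`h = ⌈(h₁ + h₂) / 2⌉`, test the feasibility problem with index `sel h`, and replace `h₁` by `h` if it
is feasible and `h₂` by `h` if not. At the end solve the optimization problem with index `sel h`,
where `h = ⌈(h₁ + h₂) / 2⌉`, and output its solution. -/
def bisection {α : Type} (sel : ℕ → ℕ) (h₁ h₂ : ℕ) : Procedure α :=
  if h₂ + 1 < h₁ then
    .test (sel ((h₁ + h₂ + 1) / 2)) (bisection sel ((h₁ + h₂ + 1) / 2) h₂)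
      (bisection sel h₁ ((h₁ + h₂ + 1) / 2))
  else .optimize (sel ((h₁ + h₂ + 1) / 2)) .output
termination_by h₁ - h₂
decreasing_by all_goals omega

namespace Model

variable {T N K : ℕ} (D : Model T N K)

/-- Binary search over the levels, starting from `h₁ = J + 1` and `h₂ = 0`. The problems at step `h`
are those of the index that level selection assigns to the level of the `h`-th prospect. That index
is `h` itself unless the value of the `h`-th prospect is repeated further down the list. -/
def levelSearch (M : ℕ) (vs : Prospect T N → ℝ) (e : Fin (2 * K + 1) ≃ Label K) :
    Procedure ((Fin M → ℝ) × ℝ) :=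
  bisection (fun h => D.kappa vs e (D.level vs e h)) (2 * K + 2) 0

end Model

end PRO

end

namespace PRO

/-! ### Choice functions -/

section ChoiceFunctions

variable {T N : ℕ}

/-! Write ψ for `lawRCF`. The ambiguity set is closed under pointwise infima, so ψ belongs to it. A
feasible point of the value problem yields a member below it on Θ_L, namely the infimum of all
permuted ridges; conversely each member, with its supporting vectors, is feasible. Hence v* is ψ
restricted to Θ_L (`IsValueSolution.eq_lawRCF`).

For v*_{j+1} < u ≤ v*_j, ψ(X) ≥ u holds exactly when X dominates a mixture of the prospects σ(θ) -
(v*_θ - u)/C with θ among the first j. Such mixtures have ψ ≥ u by the Lipschitz bound and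
quasi-concavity. If X dominates none, a separating vector gives a ridge at X of value below u that
lies above ψ on Θ_L; the minimum of ψ and its permutations is a member, so ψ(X) < u. Birkhoff's
theorem turns weights on permutations into the matrices ρ_θ. Eliminating p, q, ρ thus leaves v ≤
ψ(G(z)) (`mem_levelSet_image_iff`).

The problem at κ(h) is therefore feasible iff ψ∘G exceeds the next lower level somewhere on Z. The
search stops at adjacent indices h, h + 1 with h infeasible (or 0) and h + 1 feasible. So ψ∘G stays
below the level of h + 1 and exceeds the next distinct level somewhere, and the problem at κ(h + 1)
has the same maximizers as ψ∘G. -/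

/-- Monotone, quasi-concave and Lipschitz continuous functions. -/
structure IsChoice (C : ℝ) (φ : Prospect T N → ℝ) : Prop where
  mono : Monotone φ
  qco : QCo φ
  lip : Lip C φ

theorem pairing_add (s X Y : Prospect T N) : pairing s (X + Y) = pairing s X + pairing s Y := by
  simp [pairing, mul_add, Finset.sum_add_distrib]

theorem pairing_sub (s X Y : Prospect T N) : pairing s (X - Y) = pairing s X - pairing s Y := by
  simp [pairing, mul_sub, Finset.sum_sub_distrib]

theorem pairing_smul (s X : Prospect T N) (c : ℝ) : pairing s (c • X) = c * pairing s X := by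
  simp only [pairing, Finset.mul_sum, Pi.smul_apply, smul_eq_mul]
  exact Finset.sum_congr rfl fun t _ => Finset.sum_congr rfl fun n _ => by ring

theorem smul_pairing (s X : Prospect T N) (c : ℝ) : pairing (c • s) X = c * pairing s X := by
  simp only [pairing, Finset.mul_sum, Pi.smul_apply, smul_eq_mul]
  exact Finset.sum_congr rfl fun t _ => Finset.sum_congr rfl fun n _ => by ring

theorem pairing_mono {s : Prospect T N} (hs : 0 ≤ s) : Monotone (pairing s) := fun _ _ h =>
  Finset.sum_le_sum fun t _ => Finset.sum_le_sum fun n _ =>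
    mul_le_mul_of_nonneg_left (h t n) (hs t n)

theorem abs_apply_le_norm (X : Prospect T N) (t : Fin T) (n : Fin N) : |X t n| ≤ ‖X‖ :=
  (norm_le_pi_norm (X t) n).trans (norm_le_pi_norm X t)

theorem abs_pairing_le (s X : Prospect T N) : |pairing s X| ≤ oneNorm s * ‖X‖ := by
  unfold pairing oneNorm
  rw [Finset.sum_mul]
  refine (Finset.abs_sum_le_sum_abs _ _).trans (Finset.sum_le_sum fun t _ => ?_)
  rw [Finset.sum_mul]
  refine (Finset.abs_sum_le_sum_abs _ _).trans (Finset.sum_le_sum fun n _ => ?_)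
  rw [abs_mul]
  exact mul_le_mul_of_nonneg_left (abs_apply_le_norm X t n) (abs_nonneg _)

/-- The constant prospect. -/
def const (T N : ℕ) (c : ℝ) : Prospect T N := fun _ _ => c

theorem norm_const_le (c : ℝ) : ‖const T N c‖ ≤ |c| :=
  (pi_norm_le_iff_of_nonneg (abs_nonneg c)).2 fun _ =>
    (pi_norm_le_iff_of_nonneg (abs_nonneg c)).2 fun _ => le_rfl

theorem pairing_const {s : Prospect T N} (hs : 0 ≤ s) (c : ℝ) :
    pairing s (const T N c) = oneNorm s * c := by
  simp only [pairing, oneNorm, const, Finset.sum_mul]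
  exact Finset.sum_congr rfl fun t _ => Finset.sum_congr rfl fun n _ => by
    rw [abs_of_nonneg (hs t n)]

theorem oneNorm_smul {c : ℝ} (hc : 0 ≤ c) (s : Prospect T N) :
    oneNorm (c • s) = c * oneNorm s := by
  simp [oneNorm, Finset.mul_sum, abs_mul, abs_of_nonneg hc]

theorem norm_permute_le (σ : Equiv.Perm (Fin T)) (X : Prospect T N) : ‖permute σ X‖ ≤ ‖X‖ :=
  (pi_norm_le_iff_of_nonneg (norm_nonneg X)).2 fun t => norm_le_pi_norm X (σ t)

namespace IsChoice

variable {C : ℝ} {φ : Prospect T N → ℝ}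

theorem continuous (h : IsChoice C φ) : Continuous φ := by
  refine (LipschitzWith.of_dist_le_mul (K := C.toNNReal) fun X Y => ?_).continuous
  rw [Real.dist_eq, dist_eq_norm]
  exact (h.lip X Y).trans (mul_le_mul_of_nonneg_right (Real.le_coe_toNNReal C) (norm_nonneg _))

theorem convex_superlevel (h : IsChoice C φ) (u : ℝ) : Convex ℝ {X | u ≤ φ X} := by
  intro X hX Y hY a b ha hb hab
  obtain rfl : b = 1 - a := by linarith
  exact (le_min hX hY).trans (h.qco X Y a ha (by linarith))

theorem convex_strict_superlevel (h : IsChoice C φ) (u : ℝ) : Convex ℝ {X | u < φ X} := by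
  intro X hX Y hY a b ha hb hab
  obtain rfl : b = 1 - a := by linarith
  exact (lt_min hX hY).trans_le (h.qco X Y a ha (by linarith))

theorem le_add_const (h : IsChoice C φ) (hC : 0 ≤ C) (X : Prospect T N) (c : ℝ) :
    φ X - C * |c| ≤ φ (X + const T N c) := by
  have h1 := (abs_le.1 (h.lip X (X + const T N c))).2
  have h2 : ‖X - (X + const T N c)‖ ≤ |c| := by
    rw [sub_add_cancel_left, norm_neg]
    exact norm_const_le c
  have := mul_le_mul_of_nonneg_left h2 hC
  linarith

theorem comp_permute (h : IsChoice C φ) (hC : 0 ≤ C) (σ : Equiv.Perm (Fin T)) :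
    IsChoice C fun X => φ (permute σ X) where
  mono := fun _ _ hXY => h.mono fun t => hXY (σ t)
  qco := fun X Y l hl hl' => h.qco (permute σ X) (permute σ Y) l hl hl'
  lip := fun X Y => (h.lip (permute σ X) (permute σ Y)).trans
    (mul_le_mul_of_nonneg_left (norm_permute_le σ (X - Y)) hC)

/-- Every new member of the ambiguity set is built by this closure property, as is ψ itself. -/
theorem iInf {ι : Type*} [Nonempty ι] {f : ι → Prospect T N → ℝ} (h : ∀ i, IsChoice C (f i))
    (hb : ∀ X, BddBelow (Set.range fun i => f i X)) : IsChoice C fun X => ⨅ i, f i X where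
  mono := fun X Y hXY => ciInf_mono (hb X) fun i => (h i).mono hXY
  qco := fun X Y l hl hl' => le_ciInf fun i =>
    (min_le_min (ciInf_le (hb X) i) (ciInf_le (hb Y) i)).trans ((h i).qco X Y l hl hl')
  lip := by
    have key : ∀ X Y, (⨅ i, f i X) - C * ‖X - Y‖ ≤ ⨅ i, f i Y := fun X Y => le_ciInf fun i => by
      have := (abs_le.1 ((h i).lip X Y)).2
      have := ciInf_le (hb X) i
      linarith
    intro X Y
    have h1 := key X Y
    have h2 := key Y X
    rw [norm_sub_rev] at h2
    exact abs_le.2 ⟨by linarith, by linarith⟩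

theorem const_min (h : IsChoice C φ) (u : ℝ) : IsChoice C fun X => min (φ X) u where
  mono := fun _ _ hXY => min_le_min (h.mono hXY) le_rfl
  qco := fun X Y l hl hl' => le_min
    ((min_le_min (min_le_left _ _) (min_le_left _ _)).trans (h.qco X Y l hl hl'))
    ((min_le_left _ _).trans (min_le_right _ _))
  lip := fun X Y => by
    have := abs_min_sub_min_le_max (φ X) u (φ Y) u
    rw [sub_self, abs_zero, max_eq_left (abs_nonneg _)] at this
    exact this.trans (h.lip X Y)

end IsChoice

/-! ### Ridges, supporting vectors and separation. -/

/-- The quasi-linear function that is supported by `s` at `θ`. -/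
def ridge (s θ : Prospect T N) (a : ℝ) (X : Prospect T N) : ℝ := a + max (pairing s (X - θ)) 0

theorem le_ridge (s θ : Prospect T N) (a : ℝ) (X : Prospect T N) : a ≤ ridge s θ a X :=
  le_add_of_nonneg_right (le_max_right _ _)

theorem ridge_self (s θ : Prospect T N) (a : ℝ) : ridge s θ a θ = a := by
  simp [ridge, pairing]

theorem isChoice_ridge {C : ℝ} {s : Prospect T N} (hs : 0 ≤ s) (hsC : oneNorm s ≤ C)
    (θ : Prospect T N) (a : ℝ) : IsChoice C (ridge s θ a) where
  mono := fun X Y h => add_le_add_right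
    (max_le_max (pairing_mono hs (sub_le_sub_right h θ)) le_rfl) a
  qco := fun X Y l hl hl' => by
    unfold ridge
    rw [min_add_add_left, ← max_min_distrib_right]
    refine add_le_add_right (max_le_max ?_ le_rfl) a
    have hd : l • X + (1 - l) • Y - θ = l • (X - θ) + (1 - l) • (Y - θ) := by module
    rw [hd, pairing_add, pairing_smul, pairing_smul]
    have h1 := mul_le_mul_of_nonneg_left (min_le_left (pairing s (X - θ)) (pairing s (Y - θ))) hl
    have h2 := mul_le_mul_of_nonneg_left (min_le_right (pairing s (X - θ)) (pairing s (Y - θ)))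
      (sub_nonneg.2 hl')
    linarith
  lip := fun X Y => by
    have h1 := abs_max_sub_max_le_abs (pairing s (X - θ)) (pairing s (Y - θ)) 0
    rw [← pairing_sub, sub_sub_sub_cancel_right] at h1
    unfold ridge
    rw [add_sub_add_left_eq_sub]
    exact h1.trans ((abs_pairing_le s _).trans
      (mul_le_mul_of_nonneg_right hsC (norm_nonneg _)))

/-- The representing vector of a linear functional. -/
def normal (f : StrongDual ℝ (Prospect T N)) : Prospect T N :=
  fun t n => f (Pi.single t (Pi.single n 1))

theorem pairing_normal (f : StrongDual ℝ (Prospect T N)) (X : Prospect T N) :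
    pairing (normal f) X = f X := by
  have hX : X = ∑ t, ∑ n, X t n • (Pi.single t (Pi.single n (1 : ℝ)) : Prospect T N) := by
    ext t n
    simp [Finset.sum_apply, Pi.single_apply, ite_apply]
  conv_rhs => rw [hX]
  simp only [map_sum, map_smul, smul_eq_mul, pairing, normal]
  exact Finset.sum_congr rfl fun t _ => Finset.sum_congr rfl fun n _ => mul_comm _ _

theorem single_nonneg (t : Fin T) (n : Fin N) :
    (0 : Prospect T N) ≤ Pi.single t (Pi.single n (1 : ℝ)) :=
  Pi.single_nonneg.2 (Pi.single_nonneg.2 zero_le_one)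

/-- A functional that is bounded below on an upper set is represented by a nonnegative vector. -/
theorem normal_nonneg {f : StrongDual ℝ (Prospect T N)} {X : Prospect T N} {u : ℝ}
    (h : ∀ Y, X ≤ Y → u < f Y) : 0 ≤ normal f := by
  intro t n
  by_contra hlt
  have hlt : f (Pi.single t (Pi.single n 1)) < 0 := not_le.1 hlt
  set E : Prospect T N := Pi.single t (Pi.single n 1)
  -- Moving far enough along a direction on which `f` is negative stays in the upper set but drives
  -- `f` below `u`.
  obtain ⟨m, hm⟩ := exists_nat_gt ((f X - u) / -f E)
  have h1 := h (X + (m : ℝ) • E)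
    (le_add_of_nonneg_right (smul_nonneg m.cast_nonneg (single_nonneg t n)))
  rw [map_add, map_smul, smul_eq_mul] at h1
  rw [div_lt_iff₀ (by linarith)] at hm
  linarith

theorem oneNorm_pos {s : Prospect T N} {X : Prospect T N} (hX : pairing s X ≠ 0) :
    0 < oneNorm s := by
  have h0 : 0 ≤ oneNorm s := Finset.sum_nonneg fun t _ => Finset.sum_nonneg fun n _ => abs_nonneg _
  refine h0.lt_of_ne fun h => hX ?_
  have := abs_pairing_le s X
  rw [← h, zero_mul] at this
  exact abs_eq_zero.1 (le_antisymm this (abs_nonneg _))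

/-- A quasi-concave Lipschitz function lies below a ridge at each point. -/
theorem IsChoice.exists_support {C : ℝ} (hC : 0 < C) {φ : Prospect T N → ℝ} (h : IsChoice C φ)
    (θ : Prospect T N) :
    ∃ s : Prospect T N, 0 ≤ s ∧ oneNorm s ≤ C ∧ ∀ X, φ X ≤ ridge s θ (φ θ) X := by
  by_cases hne : ∃ X, φ θ < φ X
  · obtain ⟨X₀, hX₀⟩ := hne
    -- Separate `θ` from the open convex set `φ > φ θ`; `X₀` in this set shows that the functional
    -- is nonzero.
    obtain ⟨f, hf⟩ := geometric_hahn_banach_point_open (h.convex_strict_superlevel (φ θ))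
      (isOpen_lt continuous_const h.continuous) (lt_irrefl (φ θ))
    have hs : 0 ≤ normal f := normal_nonneg fun Y hY => hf Y (hX₀.trans_le (h.mono hY))
    have hpos : 0 < oneNorm (normal f) := by
      refine oneNorm_pos (X := X₀ - θ) ?_
      rw [pairing_normal, map_sub]
      exact (sub_pos.2 (hf X₀ hX₀)).ne'
    -- Rescale to norm exactly `C`: lowering a prospect by `r / C` then lowers the pairing by
    -- exactly `r`, and `φ` by at most `r`.
    have hc : 0 < C / oneNorm (normal f) := div_pos hC hpos
    have hnorm : oneNorm ((C / oneNorm (normal f)) • normal f) = C := by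
      rw [oneNorm_smul hc.le, div_mul_cancel₀ _ hpos.ne']
    refine ⟨(C / oneNorm (normal f)) • normal f, smul_nonneg hc.le hs, hnorm.le, fun X => ?_⟩
    rcases le_or_gt (φ X) (φ θ) with hX | hX
    · exact hX.trans (le_ridge _ _ _ _)
    refine le_trans ?_ (add_le_add_right (le_max_left _ _) _)
    rw [← sub_le_iff_le_add']
    -- For `0 ≤ r < φ X - φ θ`, the prospect `X` lowered by `r / C` still has value above `φ θ`, so
    -- the separation yields `r < ⟨s, X - θ⟩`.
    refine le_of_forall_lt fun r hr => ?_
    rcases lt_or_ge r 0 with hr0 | hr0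
    · refine hr0.trans_le ?_
      rw [smul_pairing, pairing_normal, map_sub]
      exact mul_nonneg hc.le (sub_nonneg.2 (hf X hX).le)
    have h1 : φ θ < φ (X + const T N (-(r / C))) := by
      have := h.le_add_const hC.le X (-(r / C))
      rw [abs_neg, abs_of_nonneg (by positivity), mul_div_cancel₀ _ hC.ne'] at this
      linarith
    have h2 := mul_lt_mul_of_pos_left (sub_pos.2 (hf _ h1)) hc
    rw [← map_sub, ← pairing_normal, ← smul_pairing, add_sub_right_comm, pairing_add,
      pairing_const (smul_nonneg hc.le hs), hnorm, mul_zero, mul_neg,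
      mul_div_cancel₀ _ hC.ne'] at h2
    linarith
  · push Not at hne
    refine ⟨0, le_rfl, by simp [oneNorm, hC.le], fun X => (hne X).trans (le_ridge _ _ _ _)⟩

/-- Either some mixture of finitely many prospects is dominated by `X`, or a nonnegative vector
separates all of them from `X`. -/
theorem exists_mixture_le_or_exists_separation {C : ℝ} (hC : 0 < C) {ι : Type*} [Fintype ι]
    [Nonempty ι] (a : ι → Prospect T N) (X : Prospect T N) :
    (∃ w ∈ stdSimplex ℝ ι, ∑ i, w i • a i ≤ X) ∨
      ∃ s : Prospect T N, 0 ≤ s ∧ oneNorm s = C ∧ ∀ i, 0 < pairing s (a i - X) := by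
  classical
  by_cases hd : ∃ w ∈ stdSimplex ℝ ι, ∑ i, w i • a i ≤ X
  · exact Or.inl hd
  right
  let A : (ι → ℝ) →ₗ[ℝ] Prospect T N := Fintype.linearCombination ℝ a
  have hA : ∀ w, A w = ∑ i, w i • a i := fun w => Fintype.linearCombination_apply ℝ a w
  -- The compact polytope of mixtures misses the closed set of prospects below `X`. Since `f` is
  -- larger on the latter, `-f` is the nonnegative functional.
  obtain ⟨f, u, v, hu, huv, hv⟩ := geometric_hahn_banach_compact_closed
    ((convex_stdSimplex ℝ ι).linear_image A)
    ((isCompact_stdSimplex ℝ ι).image A.continuous_of_finiteDimensional)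
    (convex_Iic X) isClosed_Iic (by
      rw [Set.disjoint_left]
      rintro _ ⟨w, hw, rfl⟩ hle
      exact hd ⟨w, hw, (hA w).symm.le.trans hle⟩)
  have ha : ∀ i, f (a i) < f X := fun i => by
    have := hu (A (Pi.single i 1)) ⟨_, single_mem_stdSimplex ℝ i, rfl⟩
    rw [hA] at this
    simp only [Pi.single_apply, ite_smul, one_smul, zero_smul, Finset.sum_ite_eq',
      Finset.mem_univ, if_true] at this
    exact this.trans (huv.trans (hv X self_mem_Iic))
  have hs : 0 ≤ normal (-f) := by
    refine normal_nonneg (X := -X) (u := v) fun Y hY => ?_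
    rw [_root_.neg_apply, ← map_neg]
    exact hv _ (neg_le.1 hY)
  have hp : ∀ i, 0 < pairing (normal (-f)) (a i - X) := fun i => by
    rw [pairing_normal, _root_.neg_apply, map_sub]
    linarith [ha i]
  have hpos := oneNorm_pos (hp (Classical.arbitrary ι)).ne'
  have hc : 0 < C / oneNorm (normal (-f)) := div_pos hC hpos
  refine ⟨(C / oneNorm (normal (-f))) • normal (-f), smul_nonneg hc.le hs, ?_, fun i => ?_⟩
  · rw [oneNorm_smul hc.le, div_mul_cancel₀ _ hpos.ne']
  · rw [smul_pairing]
    exact mul_pos hc (hp i)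

end ChoiceFunctions

/-! ### Law invariance -/

/-- Functions on a finite type whose fibers are equipotent agree up to a permutation. -/
theorem exists_perm_comp_eq {α β : Type*} {f g : α → β}
    (h : ∀ b, Nonempty ({a // f a = b} ≃ {a // g a = b})) : ∃ σ : Equiv.Perm α, g ∘ σ = f := by
  refine ⟨(Equiv.sigmaFiberEquiv f).symm.trans
    ((Equiv.sigmaCongrRight fun b => (h b).some).trans (Equiv.sigmaFiberEquiv g)), ?_⟩
  funext a
  exact ((h (f a)).some ⟨a, rfl⟩).2

theorem identDistrib_permute {T N : ℕ} (σ : Equiv.Perm (Fin T)) (X : Prospect T N) :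
    IdentDistrib (permute σ X) X (refProb T) (refProb T) where
  aemeasurable_fst := (measurable_of_finite _).aemeasurable
  aemeasurable_snd := (measurable_of_finite _).aemeasurable
  map_eq := by
    ext S hS
    rw [Measure.map_apply (measurable_of_finite _) hS, Measure.map_apply (measurable_of_finite _) hS,
      refProb, uniformOn_univ, uniformOn_univ]
    congr 1
    have : permute σ X ⁻¹' S = σ.symm '' (X ⁻¹' S) := by
      rw [Equiv.image_symm_eq_preimage]
      rfl
    rw [this, Measure.count_injective_image σ.symm.injective]

/-- Under the uniform probability, equal point masses mean equipotent fibers; the factor `1 / T`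
cancels in `ENNReal` because it is neither `0` nor `∞`. -/
theorem exists_permute_eq_of_identDistrib {T N : ℕ} (hT : 1 ≤ T) {X Y : Prospect T N}
    (h : IdentDistrib X Y (refProb T) (refProb T)) : ∃ σ : Equiv.Perm (Fin T), permute σ Y = X := by
  classical
  refine exists_perm_comp_eq fun b => ?_
  have hb := h.measure_mem_eq (measurableSet_singleton b)
  have hT' : (T : ENNReal) ≠ 0 := by
    rw [Nat.cast_ne_zero]
    omega
  rw [refProb, uniformOn_univ, uniformOn_univ, Fintype.card_fin,
    ENNReal.div_eq_inv_mul, ENNReal.div_eq_inv_mul,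
    ENNReal.mul_right_inj (ENNReal.inv_ne_zero.2 (ENNReal.natCast_ne_top T))
      (ENNReal.inv_ne_top.2 hT'),
    Measure.count_apply (Set.toFinite _).measurableSet,
    Measure.count_apply (Set.toFinite _).measurableSet,
    ENat.toENNReal_inj, (Set.toFinite _).encard_eq_coe_toFinset_card,
    (Set.toFinite _).encard_eq_coe_toFinset_card, Nat.cast_inj] at hb
  refine Fintype.card_eq.1 ?_
  rw [Fintype.card_subtype, Fintype.card_subtype]
  convert hb using 2 <;> ext <;> simp

theorem lawInvariant_iff {T N : ℕ} (hT : 1 ≤ T) (φ : Prospect T N → ℝ) :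
    LawInvariant φ ↔ ∀ σ X, φ (permute σ X) = φ X := by
  refine ⟨fun h σ X => h _ _ (identDistrib_permute σ X), fun h X Y hXY => ?_⟩
  obtain ⟨σ, rfl⟩ := exists_permute_eq_of_identDistrib hT hXY
  exact h σ Y

namespace Model

variable {T N K : ℕ} {D : Model T N K}

theorem mem_lawAmbiguitySet_iff (hT : 1 ≤ T) {φ : Prospect T N → ℝ} :
    φ ∈ D.lawAmbiguitySet ↔ IsChoice D.C φ ∧ (∀ σ X, φ (permute σ X) = φ X) ∧ φ D.W₀ = 0 ∧
      ∀ k, φ (D.Y k) ≤ φ (D.W k) := by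
  rw [← lawInvariant_iff hT]
  constructor
  · rintro ⟨-, h1, h2, h3, h4, h5, h6⟩
    exact ⟨⟨h1, h2, h4⟩, h5, h3, h6⟩
  · rintro ⟨h, h1, h2, h3⟩
    exact ⟨h.continuous.upperSemicontinuous, h.mono, h.qco, h2, h.lip, h1, h3⟩

/-- Normalization at `W₀` and the Lipschitz bound confine the values, so the real `⨅` in `lawRCF` is
a true infimum over a nonempty set and not a default value. -/
theorem bddBelow_lawAmbiguitySet (X : Prospect T N) :
    BddBelow (Set.range fun φ : D.lawAmbiguitySet => (φ : Prospect T N → ℝ) X) := by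
  refine ⟨-(D.C * ‖X - D.W₀‖), ?_⟩
  rintro _ ⟨⟨φ, -, -, -, h0, hl, -⟩, rfl⟩
  have := (abs_le.1 (hl X D.W₀)).1
  rwa [h0, sub_zero] at this

theorem lawRCF_le {φ : Prospect T N → ℝ} (hφ : φ ∈ D.lawAmbiguitySet) (X : Prospect T N) :
    D.lawRCF X ≤ φ X :=
  ciInf_le (bddBelow_lawAmbiguitySet X) (⟨φ, hφ⟩ : D.lawAmbiguitySet)

theorem lawRCF_mem (hT : 1 ≤ T) (hne : D.lawAmbiguitySet.Nonempty) :
    D.lawRCF ∈ D.lawAmbiguitySet := by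
  have : Nonempty D.lawAmbiguitySet := hne.to_subtype
  have hm := fun φ : D.lawAmbiguitySet => (mem_lawAmbiguitySet_iff hT).1 φ.2
  refine (mem_lawAmbiguitySet_iff hT).2 ⟨IsChoice.iInf (fun φ => (hm φ).1)
    bddBelow_lawAmbiguitySet, fun σ X => ?_, ?_, fun k => ?_⟩
  · exact iInf_congr fun φ => (hm φ).2.1 σ X
  · exact (iInf_congr fun φ => (hm φ).2.2.1).trans ciInf_const
  · exact ciInf_mono (bddBelow_lawAmbiguitySet _) fun φ => (hm φ).2.2.2 k

theorem permute_mem_thetaL {θ : Prospect T N} (h : θ ∈ D.thetaL) (σ : Equiv.Perm (Fin T)) :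
    permute σ θ ∈ D.thetaL := by
  classical
  obtain ⟨⟨τ, l⟩, -, rfl⟩ := Finset.mem_image.1 h
  exact Finset.mem_image.2 ⟨(τ * σ, l), Finset.mem_univ _, rfl⟩

theorem prospect_mem_thetaL (l : Label K) : D.prospect l ∈ D.thetaL := by
  classical
  exact Finset.mem_image.2 ⟨(1, l), Finset.mem_univ _, rfl⟩

/-! ### The value problem -/

/-- A feasible point of the value problem dominates an element of the ambiguity set. -/
theorem ValueFeasible.exists_mem_le (hT : 1 ≤ T) (hC : 0 < D.C) {v : Prospect T N → ℝ}
    {s : Prospect T N → Prospect T N} (h : D.ValueFeasible v s) :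
    ∃ φ ∈ D.lawAmbiguitySet, ∀ θ ∈ D.thetaL, φ θ ≤ v θ := by
  obtain ⟨h1, h2, h3, h4⟩ := h
  let f : Equiv.Perm (Fin T) × D.thetaL → Prospect T N → ℝ :=
    fun i X => ridge (s i.2) i.2 (v i.2) (permute i.1 X)
  let φ : Prospect T N → ℝ := fun X => ⨅ i, f i X
  have : Nonempty D.thetaL := ⟨⟨_, prospect_mem_thetaL none⟩⟩
  have hb : ∀ X, BddBelow (Set.range fun i => f i X) := fun X => (Set.finite_range _).bddBelow
  -- The first value constraint says that the ridge centred at one point of Θ_L lies above `v` at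
  -- all the others.
  have hf : ∀ i, ∀ θ ∈ D.thetaL, v (permute i.1 θ) ≤ f i θ := by
    rintro ⟨σ, θ', hθ'⟩ θ hθ
    by_cases he : θ' = permute σ θ
    · subst he
      exact (ridge_self _ _ _).ge
    · exact h1 θ' hθ' _ (permute_mem_thetaL hθ σ) he
  have hφ : ∀ σ, ∀ θ ∈ D.thetaL, φ θ ≤ v (permute σ θ) := fun σ θ hθ =>
    (ciInf_le (hb θ) (σ, ⟨_, permute_mem_thetaL hθ σ⟩)).trans (ridge_self _ _ _).le
  refine ⟨φ, (mem_lawAmbiguitySet_iff hT).2 ⟨IsChoice.iInf (fun i =>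
    (isChoice_ridge (h2 i.2 i.2.2).1 (h2 i.2 i.2.2).2 _ _).comp_permute hC.le i.1) hb,
    fun σ X => ?_, ?_, fun k => ?_⟩, fun θ hθ => hφ 1 θ hθ⟩
  -- Permuting `X` only reindexes the permutations over which the infimum is taken.
  · exact ((Equiv.mulLeft σ).prodCongr (Equiv.refl _)).iInf_congr fun i => rfl
  · have hm : D.W₀ ∈ D.thetaL := prospect_mem_thetaL none
    refine le_antisymm ((hφ 1 _ hm).trans (h4 1).le) (le_ciInf fun i => ?_)
    exact (h4 i.1).ge.trans (hf i _ hm)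
  -- A ridge evaluated at a permuted `W k` is compared with `Y k`; this is why the value problem
  -- relates all pairs of permutations.
  · exact le_ciInf fun i => (hφ 1 _ (prospect_mem_thetaL (some (Sum.inr k)))).trans
      ((h3 k i.1 1).trans (hf i _ (prospect_mem_thetaL (some (Sum.inl k)))))

/-- The elements of the ambiguity set are feasible for the value problem. -/
theorem exists_valueFeasible (hT : 1 ≤ T) (hC : 0 < D.C) {φ : Prospect T N → ℝ}
    (hφ : φ ∈ D.lawAmbiguitySet) : ∃ s, D.ValueFeasible φ s := by
  obtain ⟨h, hp, h0, hk⟩ := (mem_lawAmbiguitySet_iff hT).1 hφ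
  choose s hs hsC hsup using h.exists_support hC
  refine ⟨s, fun θ _ θ' _ _ => hsup θ θ', fun θ _ => ⟨hs θ, hsC θ⟩, fun k σ σ' => ?_, fun σ => ?_⟩
  · rw [hp, hp]
    exact hk k
  · rw [hp, h0]

theorem IsValueSolution.nonempty (hT : 1 ≤ T) (hC : 0 < D.C) {v : Prospect T N → ℝ}
    (hv : D.IsValueSolution v) : D.lawAmbiguitySet.Nonempty := by
  obtain ⟨⟨s, hs⟩, -⟩ := hv
  obtain ⟨φ, hφ, -⟩ := hs.exists_mem_le hT hC
  exact ⟨φ, hφ⟩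

/-- The optimal values are the values of the robust choice function. -/
theorem IsValueSolution.eq_lawRCF (hT : 1 ≤ T) (hC : 0 < D.C) {v : Prospect T N → ℝ}
    (hv : D.IsValueSolution v) {θ : Prospect T N} (hθ : θ ∈ D.thetaL) : v θ = D.lawRCF θ := by
  obtain ⟨s', hs'⟩ := exists_valueFeasible hT hC (lawRCF_mem hT (hv.nonempty hT hC))
  obtain ⟨⟨s, hs⟩, hopt⟩ := hv
  obtain ⟨φ, hφ, hle⟩ := hs.exists_mem_le hT hC
  have hle' : ∀ θ ∈ D.thetaL, D.lawRCF θ ≤ v θ := fun θ hθ => (lawRCF_le hφ θ).trans (hle θ hθ)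
  -- ψ is feasible and pointwise below `v` on Θ_L, so optimality of the sum forces equality at every
  -- point.
  exact ((Finset.sum_eq_sum_iff_of_le hle').1
    (le_antisymm (Finset.sum_le_sum hle') (hopt _ s' hs')) θ hθ).symm

/-- The robust choice function does not exceed the largest value. -/
theorem lawRCF_le_of_forall (hT : 1 ≤ T) (hne : D.lawAmbiguitySet.Nonempty) {u : ℝ}
    (hu : ∀ l, D.lawRCF (D.prospect l) ≤ u) (X : Prospect T N) : D.lawRCF X ≤ u := by
  obtain ⟨h, hp, h0, hk⟩ := (mem_lawAmbiguitySet_iff hT).1 (lawRCF_mem hT hne)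
  have hm : ∀ l, min (D.lawRCF (D.prospect l)) u = D.lawRCF (D.prospect l) := fun l =>
    min_eq_left (hu l)
  -- Truncating ψ at `u` changes none of its values on Θ, so the truncation is still a member.
  refine (lawRCF_le (φ := fun X => min (D.lawRCF X) u) ((mem_lawAmbiguitySet_iff hT).2
    ⟨h.const_min u, fun σ X => ?_, (hm none).trans h0, fun k => min_le_min (hk k) le_rfl⟩) X).trans
    (min_le_right _ _)
  simp only [hp]

/-- If a ridge, up to permutations, lies above the values of all elicited prospects, it bounds the
robust choice function. -/
theorem lawRCF_le_ridge (hT : 1 ≤ T) (hC : 0 < D.C) (hne : D.lawAmbiguitySet.Nonempty)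
    {s : Prospect T N} (hs : 0 ≤ s) (hsC : oneNorm s ≤ D.C) (X : Prospect T N) (a : ℝ)
    (h : ∀ l σ, D.lawRCF (D.prospect l) ≤ ridge s X a (permute σ (D.prospect l))) :
    D.lawRCF X ≤ a := by
  obtain ⟨hψ, hp, h0, hk⟩ := (mem_lawAmbiguitySet_iff hT).1 (lawRCF_mem hT hne)
  -- The minimum of ψ (index `none`) and all permuted ridges agrees with ψ on Θ, hence is a member;
  -- at `X` the identity permutation gives `a`.
  let f : Option (Equiv.Perm (Fin T)) → Prospect T N → ℝ :=
    fun o Y => o.elim (D.lawRCF Y) fun σ => ridge s X a (permute σ Y)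
  have hb : ∀ Y, BddBelow (Set.range fun i => f i Y) := fun Y => (Set.finite_range _).bddBelow
  have hθ : ∀ l, ⨅ o, f o (D.prospect l) = D.lawRCF (D.prospect l) := fun l => by
    refine le_antisymm (ciInf_le (hb _) none) (le_ciInf fun o => ?_)
    cases o with
    | none => exact le_rfl
    | some σ => exact h l σ
  refine (lawRCF_le (φ := fun Y => ⨅ o, f o Y) ((mem_lawAmbiguitySet_iff hT).2
    ⟨IsChoice.iInf (fun o => ?_) hb, fun σ Y => ?_, (hθ none).trans h0, fun k =>
      (hθ (some (Sum.inr k))).le.trans ((hk k).trans (hθ (some (Sum.inl k))).ge)⟩) X).trans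
    ((ciInf_le (hb X) (some 1)).trans (ridge_self s X a).le)
  · cases o with
    | none => exact hψ
    | some σ => exact (isChoice_ridge hs hsC X a).comp_permute hC.le σ
  · refine (Equiv.optionCongr (Equiv.mulLeft σ)).iInf_congr fun o => ?_
    cases o with
    | none => exact (hp σ Y).symm
    | some τ => rfl

end Model

/-! ### Mixtures of permutations -/

/-- The inverse makes the transposed matrix act as `permute σ`. -/
theorem sum_smul_permMatrix_transpose_mulVec {T : ℕ} (w : Equiv.Perm (Fin T) → ℝ)
    (x : Fin T → ℝ) (t : Fin T) :
    ((∑ σ, w σ • Equiv.Perm.permMatrix ℝ σ⁻¹)ᵀ *ᵥ x) t = ∑ σ, w σ * x (σ t) := by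
  simp only [Matrix.transpose_sum, Matrix.transpose_smul, Matrix.transpose_permMatrix, inv_inv,
    Matrix.sum_mulVec, Matrix.smul_mulVec, Matrix.permMatrix_mulVec, Finset.sum_apply,
    Pi.smul_apply, smul_eq_mul, Function.comp_apply]

/-- Birkhoff's theorem for matrices all of whose rows and columns have the sum `p`. -/
theorem exists_eq_sum_smul_permMatrix {T : ℕ} {ρ : Matrix (Fin T) (Fin T) ℝ} {p : ℝ}
    (hp : 0 ≤ p) (hcol : (1 : Fin T → ℝ) ᵥ* ρ = fun _ => p)
    (hrow : ρ *ᵥ (1 : Fin T → ℝ) = fun _ => p) (h0 : ∀ t t', 0 ≤ ρ t t') :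
    ∃ w : Equiv.Perm (Fin T) → ℝ, (∀ σ, 0 ≤ w σ) ∧ ∑ σ, w σ = p ∧
      ρ = ∑ σ, w σ • Equiv.Perm.permMatrix ℝ σ⁻¹ := by
  obtain ⟨M, hM, rfl⟩ := (exists_mem_doublyStochastic_eq_smul_iff hp).2 ⟨h0,
    fun i => by simpa [Matrix.mulVec, dotProduct] using congrFun hrow i,
    fun j => by simpa [Matrix.vecMul, dotProduct] using congrFun hcol j⟩
  obtain ⟨w, hw0, hw1, rfl⟩ := exists_eq_sum_perm_of_mem_doublyStochastic hM
  refine ⟨fun σ => p * w σ⁻¹, fun σ => mul_nonneg hp (hw0 _), ?_, ?_⟩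
  · rw [← Finset.mul_sum, show ∑ σ, w σ⁻¹ = 1 from
      (Equiv.sum_comp (Equiv.inv (Equiv.Perm (Fin T))) w).trans hw1, mul_one]
  · rw [Finset.smul_sum, ← Equiv.sum_comp (Equiv.inv (Equiv.Perm (Fin T)))]
    exact Finset.sum_congr rfl fun σ _ => smul_smul _ _ _

theorem sum_smul_permMatrix_spec {T : ℕ} {w : Equiv.Perm (Fin T) → ℝ} (hw : ∀ σ, 0 ≤ w σ) :
    (1 : Fin T → ℝ) ᵥ* (∑ σ, w σ • Equiv.Perm.permMatrix ℝ σ⁻¹) = (fun _ => ∑ σ, w σ) ∧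
      (∑ σ, w σ • Equiv.Perm.permMatrix ℝ σ⁻¹) *ᵥ (1 : Fin T → ℝ) = (fun _ => ∑ σ, w σ) ∧
      ∀ t t', 0 ≤ (∑ σ, w σ • Equiv.Perm.permMatrix ℝ σ⁻¹) t t' := by
  refine ⟨?_, ?_, fun t t' => ?_⟩
  · funext t
    rw [← Matrix.mulVec_transpose, sum_smul_permMatrix_transpose_mulVec]
    simp
  · funext t
    simp only [Matrix.sum_mulVec, Matrix.smul_mulVec, Matrix.permMatrix_mulVec, Finset.sum_apply,
      Pi.smul_apply, smul_eq_mul, Function.comp_apply, Pi.one_apply, mul_one]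
  · rw [Matrix.sum_apply]
    refine Finset.sum_nonneg fun σ _ => mul_nonneg (hw σ) ?_
    exact nonneg_of_mem_doublyStochastic permMatrix_mem_doublyStochastic

namespace Model

variable {T N K M : ℕ} {D : Model T N K}

/-! ### Levels -/

theorem level_succ (v : Prospect T N → ℝ) (e : Fin (2 * K + 1) ≃ Label K)
    (i : Fin (2 * K + 1)) : D.level v e (i + 1) = (v (D.prospect (e i)) : ℝ) := by
  have : 1 ≤ (i : ℕ) + 1 ∧ (i : ℕ) + 1 ≤ 2 * K + 1 := ⟨by omega, i.2⟩
  rw [level, dif_pos this]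
  rfl

theorem level_eq_bot {v : Prospect T N → ℝ} {e : Fin (2 * K + 1) ≃ Label K} {j : ℕ}
    (hj : ¬(1 ≤ j ∧ j ≤ 2 * K + 1)) : D.level v e j = ⊥ := dif_neg hj

theorem exists_level_eq {v : Prospect T N → ℝ} {e : Fin (2 * K + 1) ≃ Label K} {j : ℕ} {u : ℝ}
    (hu : (u : EReal) ≤ D.level v e j) : ∃ i : Fin (2 * K + 1), (i : ℕ) + 1 = j := by
  by_cases hj : 1 ≤ j ∧ j ≤ 2 * K + 1
  · exact ⟨⟨j - 1, by omega⟩, by simp; omega⟩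
  · rw [level_eq_bot hj] at hu
    exact absurd hu (not_le.2 (EReal.bot_lt_coe u))

/-- Index `0` is excluded because `level` takes the value `⊥` there as well. -/
theorem IsDecomposition.level_anti {v : Prospect T N → ℝ} {e : Fin (2 * K + 1) ≃ Label K}
    (he : D.IsDecomposition v e) {h j : ℕ} (hh : 1 ≤ h) (hj : h ≤ j) :
    D.level v e j ≤ D.level v e h := by
  by_cases hj' : 1 ≤ j ∧ j ≤ 2 * K + 1
  · obtain ⟨a, rfl⟩ := Nat.exists_eq_add_of_le' hh
    obtain ⟨b, rfl⟩ := Nat.exists_eq_add_of_le' hj'.1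
    have h1 := level_succ (D := D) v e ⟨a, by omega⟩
    have h2 := level_succ (D := D) v e ⟨b, by omega⟩
    rw [h1, h2, EReal.coe_le_coe_iff]
    exact he (Fin.mk_le_mk.2 (by omega))
  · rw [level_eq_bot hj']
    exact bot_le

theorem IsDecomposition.le_of_lt {v : Prospect T N → ℝ} {e : Fin (2 * K + 1) ≃ Label K}
    (he : D.IsDecomposition v e) {j : ℕ} {u : ℝ} (hu : (u : EReal) ≤ D.level v e j)
    {i : Fin (2 * K + 1)} (hi : (i : ℕ) < j) : u ≤ v (D.prospect (e i)) := by
  rw [← EReal.coe_le_coe_iff, ← level_succ]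
  exact hu.trans (he.level_anti (by omega) hi)

theorem IsDecomposition.lt_of_le {v : Prospect T N → ℝ} {e : Fin (2 * K + 1) ≃ Label K}
    (he : D.IsDecomposition v e) {j : ℕ} {u : ℝ} (hu : D.level v e (j + 1) < (u : EReal))
    {i : Fin (2 * K + 1)} (hi : j ≤ (i : ℕ)) : v (D.prospect (e i)) < u := by
  rw [← EReal.coe_lt_coe_iff, ← level_succ]
  exact (he.level_anti (by omega) (by omega)).trans_lt hu

/-! ### The level constraints expressed through ψ. -/

/-- The prospect `σ(θ)`, lowered by `(v_θ - u) / C`. -/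
noncomputable def lowered (D : Model T N K) (v : Prospect T N → ℝ) (u : ℝ) (l : Label K)
    (σ : Equiv.Perm (Fin T)) : Prospect T N :=
  permute σ (D.prospect l) + const T N (-((v (D.prospect l) - u) / D.C))

/-- As the weights sum to one, the individual shifts merge into one constant, the largest `q` that
the value constraint allows. -/
theorem sum_lowered_apply {ι : Type*} [Fintype ι] (v : Prospect T N → ℝ) (u : ℝ) (l : ι → Label K)
    (w : ι × Equiv.Perm (Fin T) → ℝ) (hw : ∑ x, w x = 1) (t : Fin T) (n : Fin N) :
    (∑ x, w x • D.lowered v u (l x.1) x.2) t n =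
      ∑ i, ((∑ σ, w (i, σ) • Equiv.Perm.permMatrix ℝ σ⁻¹)ᵀ *ᵥ
        fun t' => D.prospect (l i) t' n) t -
      (∑ i, v (D.prospect (l i)) * ∑ σ, w (i, σ) - u) / D.C := by
  have hu : u = ∑ i, u * ∑ σ, w (i, σ) := by
    rw [← Finset.mul_sum, ← Fintype.sum_prod_type, hw, mul_one]
  simp only [sum_smul_permMatrix_transpose_mulVec]
  conv_rhs => rw [hu]
  rw [Finset.sum_apply, Finset.sum_apply, Fintype.sum_prod_type, ← Finset.sum_sub_distrib,
    Finset.sum_div, ← Finset.sum_sub_distrib]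
  refine Finset.sum_congr rfl fun i _ => ?_
  rw [← sub_mul, mul_div_right_comm, Finset.mul_sum, ← Finset.sum_sub_distrib]
  refine Finset.sum_congr rfl fun σ _ => ?_
  simp only [lowered, const, permute, Pi.smul_apply, Pi.add_apply, smul_eq_mul]
  ring

theorem levelConstraints_value_le (hT : 1 ≤ T) (hC : 0 < D.C) {Z : Set (Fin M → ℝ)}
    {G : (Fin M → ℝ) → Prospect T N} {vs : Prospect T N → ℝ} (hvs : D.IsValueSolution vs)
    {e : Fin (2 * K + 1) ≃ Label K} (he : D.IsDecomposition vs e) {j : ℕ} {z : Fin M → ℝ}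
    {v : ℝ} {p : Pos K j → ℝ} {q : ℝ} {ρ : Pos K j → Matrix (Fin T) (Fin T) ℝ}
    (h : D.LevelConstraints Z G vs e j z v p q ρ) : v ≤ D.lawRCF (G z) := by
  obtain ⟨-, -, hle, hv, hG, hp1, hp0, hq, hρ⟩ := h
  choose w hw0 hw1 hw using fun i =>
    exists_eq_sum_smul_permMatrix (hp0 i) (hρ i).1 (hρ i).2.1 (hρ i).2.2
  obtain ⟨hψ, hperm, -⟩ := (mem_lawAmbiguitySet_iff hT).1 (lawRCF_mem hT (hvs.nonempty hT hC))
  have hsum : ∑ x : Pos K j × Equiv.Perm (Fin T), w x.1 x.2 = 1 := by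
    rw [Fintype.sum_prod_type]
    simp only [hw1, hp1]
  -- Lowering `σ(θ)` by `(v_θ - v) / C` costs at most `v_θ - v`, so each lowered prospect, and then
  -- their mixture, has ψ at least `v`.
  have hmem := (hψ.convex_superlevel v).sum_mem (t := Finset.univ)
    (w := fun x : Pos K j × Equiv.Perm (Fin T) => w x.1 x.2)
    (z := fun x => D.lowered vs v (e x.1.1) x.2) (fun x _ => hw0 _ _) hsum fun x _ => by
      have h1 := hψ.le_add_const hC.le (permute x.2 (D.prospect (e x.1.1)))
        (-((vs (D.prospect (e x.1.1)) - v) / D.C))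
      have h2 := sub_nonneg.2 (he.le_of_lt hle x.1.2)
      rw [hperm, ← hvs.eq_lawRCF hT hC (prospect_mem_thetaL _), abs_neg,
        abs_of_nonneg (div_nonneg h2 hC.le), mul_div_cancel₀ _ hC.ne', sub_sub_cancel] at h1
      exact h1
  refine le_trans hmem (hψ.mono fun t n => ?_)
  rw [sum_lowered_apply vs v (fun i : Pos K j => e i.1) (fun x => w x.1 x.2) hsum t n]
  simp only [hw1, ← hw]
  have h1 := hG n t
  have h2 : q ≤ (∑ i : Pos K j, vs (D.prospect (e i.1)) * p i - v) / D.C := by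
    rw [le_div_iff₀ hC]
    linarith
  linarith

theorem exists_levelConstraints (hT : 1 ≤ T) (hC : 0 < D.C) {Z : Set (Fin M → ℝ)}
    {G : (Fin M → ℝ) → Prospect T N} {vs : Prospect T N → ℝ} (hvs : D.IsValueSolution vs)
    {e : Fin (2 * K + 1) ≃ Label K} (he : D.IsDecomposition vs e) {j : ℕ} {z : Fin M → ℝ}
    (hz : z ∈ Z) {v : ℝ} (hlt : D.level vs e (j + 1) < (v : EReal))
    (hle : (v : EReal) ≤ D.level vs e j) (hv : v ≤ D.lawRCF (G z)) :
    ∃ p q ρ, D.LevelConstraints Z G vs e j z v p q ρ := by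
  have : Nonempty (Pos K j) := by
    obtain ⟨i, hi⟩ := exists_level_eq hle
    exact ⟨⟨i, by omega⟩⟩
  rcases exists_mixture_le_or_exists_separation hC
    (fun x : Pos K j × Equiv.Perm (Fin T) => D.lowered vs v (e x.1.1) x.2) (G z) with
    ⟨w, ⟨hw0, hw1⟩, hw⟩ | ⟨s, hs, hsC, hsep⟩
  · have hp0 : ∀ i, 0 ≤ ∑ σ, w (i, σ) := fun i => Finset.sum_nonneg fun σ _ => hw0 _
    have hp1 : ∑ i, ∑ σ, w (i, σ) = 1 := by rw [← Fintype.sum_prod_type, hw1]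
    have hge : v ≤ ∑ i : Pos K j, vs (D.prospect (e i.1)) * ∑ σ, w (i, σ) := by
      calc v = ∑ i : Pos K j, v * ∑ σ, w (i, σ) := by rw [← Finset.mul_sum, hp1, mul_one]
        _ ≤ _ := Finset.sum_le_sum fun i _ =>
          mul_le_mul_of_nonneg_right (he.le_of_lt hle i.2) (hp0 i)
    -- This `q` makes the value constraint an equality; it is nonnegative because the first `j`
    -- values are at least `v`.
    refine ⟨fun i => ∑ σ, w (i, σ),
      (∑ i : Pos K j, vs (D.prospect (e i.1)) * ∑ σ, w (i, σ) - v) / D.C,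
      fun i => ∑ σ, w (i, σ) • Equiv.Perm.permMatrix ℝ σ⁻¹, hz, hlt, hle, ?_, fun n t => ?_, hp1,
      hp0, div_nonneg (sub_nonneg.2 hge) hC.le,
      fun i => sum_smul_permMatrix_spec fun σ => hw0 (i, σ)⟩
    · rw [mul_div_cancel₀ _ hC.ne', sub_sub_cancel]
    · have := hw t n
      rw [sum_lowered_apply vs v (fun i : Pos K j => e i.1) w hw1 t n] at this
      linarith
  · exfalso
    -- Finitely many strict inequalities survive replacing `v` by a slightly smaller `u`. The ridge
    -- at `G z` with value `u` then lies above the first `j` prospects by separation and above the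
    -- rest because their values are below `u`.
    have h1 : ∀ᶠ u in nhdsWithin v (Set.Iio v), ∀ x : Pos K j × Equiv.Perm (Fin T),
        vs (D.prospect (e x.1.1)) - pairing s (permute x.2 (D.prospect (e x.1.1)) - G z) < u := by
      refine Filter.eventually_all.2 fun x => nhdsWithin_le_nhds (lt_mem_nhds ?_)
      have := hsep x
      rw [lowered, add_sub_right_comm, pairing_add, pairing_const hs, hsC, mul_neg,
        mul_div_cancel₀ _ hC.ne'] at this
      linarith
    have h2 : ∀ᶠ u in nhdsWithin v (Set.Iio v), ∀ i : {i : Fin (2 * K + 1) // j ≤ (i : ℕ)},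
        vs (D.prospect (e i.1)) < u :=
      Filter.eventually_all.2 fun i => nhdsWithin_le_nhds (lt_mem_nhds (he.lt_of_le hlt i.2))
    obtain ⟨u, ⟨hu1, hu2⟩, huv : u < v⟩ := ((h1.and h2).and self_mem_nhdsWithin).exists
    refine absurd (hv.trans (lawRCF_le_ridge hT hC (hvs.nonempty hT hC) hs hsC.le (G z) u
      fun l σ => ?_)) (not_le.2 huv)
    obtain ⟨i, rfl⟩ := e.surjective l
    rw [← hvs.eq_lawRCF hT hC (prospect_mem_thetaL _)]
    rcases lt_or_ge (i : ℕ) j with hi | hi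
    · have := hu1 (⟨i, hi⟩, σ)
      refine le_trans ?_ (add_le_add_right (le_max_left _ _) u)
      dsimp only at this
      linarith
    · exact (hu2 ⟨i, hi⟩).le.trans (le_ridge _ _ _ _)

/-- The auxiliary variables are eliminated here; the analysis of the search uses the level
constraints only through this equivalence. -/
theorem mem_levelSet_image_iff (hT : 1 ≤ T) (hC : 0 < D.C) {Z : Set (Fin M → ℝ)}
    {G : (Fin M → ℝ) → Prospect T N} {vs : Prospect T N → ℝ} (hvs : D.IsValueSolution vs)
    {e : Fin (2 * K + 1) ≃ Label K} (he : D.IsDecomposition vs e) {j : ℕ} {z : Fin M → ℝ} {v : ℝ} :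
    (∃ x ∈ D.levelSet Z G vs e j, x.1 = z ∧ x.2.1 = v) ↔
      z ∈ Z ∧ D.level vs e (j + 1) < (v : EReal) ∧ (v : EReal) ≤ D.level vs e j ∧
        v ≤ D.lawRCF (G z) := by
  constructor
  · rintro ⟨x, hx, rfl, rfl⟩
    exact ⟨hx.1, hx.2.1, hx.2.2.1, levelConstraints_value_le hT hC hvs he hx⟩
  · rintro ⟨hz, hlt, hle, hv⟩
    obtain ⟨p, q, ρ, h⟩ := exists_levelConstraints hT hC hvs he hz hlt hle hv
    exact ⟨(z, v, p, q, ρ), h, rfl, rfl⟩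

end Model

/-! ### Binary search -/

/-- All runs of the binary search end at the same index, at which the answers change. -/
theorem exists_runs_bisection_iff {α : Type} {F : ℕ → Prop} {O : ℕ → α → Prop} {sel : ℕ → ℕ}
    {U L : ℕ → Prop} (hU : ∀ h, F (sel h) → U h) (hL : ∀ h, ¬F (sel h) → L h) (h₁ h₂ : ℕ)
    (hlt : h₂ < h₁) (h₁U : U h₁) (h₂L : L h₂) :
    ∃ a h, h₂ ≤ h ∧ h < h₁ ∧ U (h + 1) ∧ L h ∧ a ≤ Nat.clog 2 (h₁ - h₂) ∧
      ∀ a' b r, Runs F O (bisection sel h₁ h₂) a' b r ↔ a' = a ∧ b = 1 ∧ O (sel (h + 1)) r := by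
  induction hg : h₁ - h₂ using Nat.strong_induction_on generalizing h₁ h₂ with
  | _ g ih =>
    subst hg
    by_cases hstep : h₂ + 1 < h₁
    -- A feasible answer leaves a gap of half the old one rounded up, an infeasible answer half
    -- rounded down, matching the recursion of `Nat.clog`.
    · have hclog := Nat.clog_of_two_le one_lt_two (show 2 ≤ h₁ - h₂ by omega)
      set m := (h₁ + h₂ + 1) / 2 with hm
      by_cases hF : F (sel m)
      · obtain ⟨a, h, h2, h1, hu, hl, ha, hr⟩ := ih (m - h₂) (by omega) m h₂ (by omega)
          (hU m hF) h₂L rfl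
        refine ⟨a + 1, h, h2, by omega, hu, hl, ?_, fun a' b r => ?_⟩
        · rw [hclog, show (h₁ - h₂ + 2 - 1) / 2 = m - h₂ by omega]
          omega
        · rw [bisection, if_pos hstep, ← hm]
          constructor
          · intro hrun
            cases hrun with
            | feasible _ hrun =>
              obtain ⟨rfl, hb⟩ := (hr _ _ _).1 hrun
              exact ⟨rfl, hb⟩
            | infeasible hF' _ => exact absurd hF hF'
          · rintro ⟨rfl, hb⟩
            exact .feasible hF ((hr _ _ _).2 ⟨rfl, hb⟩)
      · obtain ⟨a, h, h2, h1, hu, hl, ha, hr⟩ := ih (h₁ - m) (by omega) h₁ m (by omega)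
          h₁U (hL m hF) rfl
        refine ⟨a + 1, h, by omega, h1, hu, hl, ?_, fun a' b r => ?_⟩
        · rw [hclog]
          have := Nat.clog_mono_right 2 (show h₁ - m ≤ (h₁ - h₂ + 2 - 1) / 2 by omega)
          omega
        · rw [bisection, if_pos hstep, ← hm]
          constructor
          · intro hrun
            cases hrun with
            | feasible hF' _ => exact absurd hF' hF
            | infeasible _ hrun =>
              obtain ⟨rfl, hb⟩ := (hr _ _ _).1 hrun
              exact ⟨rfl, hb⟩
          · rintro ⟨rfl, hb⟩
            exact .infeasible hF ((hr _ _ _).2 ⟨rfl, hb⟩)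
    · obtain rfl : h₁ = h₂ + 1 := by omega
      refine ⟨0, h₂, le_rfl, by omega, h₁U, h₂L, Nat.zero_le _, fun a' b r => ?_⟩
      rw [bisection, if_neg hstep, show (h₂ + 1 + h₂ + 1) / 2 = h₂ + 1 by omega]
      constructor
      · intro hrun
        cases hrun with
        | optimize hO hrun =>
          cases hrun
          exact ⟨rfl, rfl, hO⟩
      · rintro ⟨rfl, rfl, hO⟩
        exact .optimize hO (.output r)

theorem clog_two_succ_le (n : ℕ) : Nat.clog 2 (n + 1) ≤ Nat.log 2 n + 1 :=
  Nat.clog_le_of_le_pow (Nat.lt_pow_succ_log_self one_lt_two n)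

namespace Model

variable {T N K M : ℕ} {D : Model T N K}

/-! ### Level selection -/

/-- Moving to the last index of a tie keeps the level and makes the next one strictly smaller, so
the interval allowed for `v` is nonempty; past the end of the list the next level is `⊥`. -/
theorem kappa_spec {v : Prospect T N → ℝ} {e : Fin (2 * K + 1) ≃ Label K}
    (he : D.IsDecomposition v e) {h : ℕ} (h1 : 1 ≤ h) (hJ : h ≤ 2 * K + 1) :
    h ≤ D.kappa v e (D.level v e h) ∧
      D.level v e (D.kappa v e (D.level v e h)) = D.level v e h ∧
      D.level v e (D.kappa v e (D.level v e h) + 1) < D.level v e h := by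
  classical
  have hle : h ≤ D.kappa v e (D.level v e h) := Nat.le_findGreatest hJ le_rfl
  refine ⟨hle, le_antisymm (he.level_anti h1 hle)
    (Nat.findGreatest_spec (P := fun j => D.level v e h ≤ D.level v e j) hJ le_rfl), ?_⟩
  by_cases hk : D.kappa v e (D.level v e h) + 1 ≤ 2 * K + 1
  · exact not_le.1 (Nat.findGreatest_is_greatest (Nat.lt_succ_self _) hk)
  · obtain ⟨i, rfl⟩ := Nat.exists_eq_add_of_le' h1
    have hi := level_succ (D := D) v e ⟨i, by omega⟩
    dsimp only at hi
    rw [level_eq_bot (j := D.kappa v e (D.level v e (i + 1)) + 1) (by omega), hi]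
    exact EReal.bot_lt_coe _

/-! ### The feasibility and optimization problems -/

theorem feasibleF_kappa_iff (hT : 1 ≤ T) (hC : 0 < D.C) {Z : Set (Fin M → ℝ)}
    {G : (Fin M → ℝ) → Prospect T N} {vs : Prospect T N → ℝ} (hvs : D.IsValueSolution vs)
    {e : Fin (2 * K + 1) ≃ Label K} (he : D.IsDecomposition vs e) {h : ℕ} (h1 : 1 ≤ h)
    (hJ : h ≤ 2 * K + 1) :
    D.FeasibleF Z G vs e (D.kappa vs e (D.level vs e h)) ↔
      ∃ z ∈ Z, D.level vs e (D.kappa vs e (D.level vs e h) + 1) < (D.lawRCF (G z) : EReal) := by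
  obtain ⟨-, hk, hlt⟩ := kappa_spec he h1 hJ
  constructor
  · rintro ⟨x, hx⟩
    obtain ⟨hz, hl, -, hv⟩ := (mem_levelSet_image_iff hT hC hvs he).1 ⟨x, hx, rfl, rfl⟩
    exact ⟨x.1, hz, hl.trans_le (EReal.coe_le_coe_iff.2 hv)⟩
  · rintro ⟨z, hz, hl⟩
    obtain ⟨i, rfl⟩ := Nat.exists_eq_add_of_le' h1
    have hi := level_succ (D := D) vs e ⟨i, by omega⟩
    dsimp only at hi
    -- ψ(G(z)) may exceed the current level, so it is capped there to land in the half-open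
    -- interval.
    obtain ⟨x, hx, -⟩ := (mem_levelSet_image_iff (G := G) (z := z)
      (j := D.kappa vs e (D.level vs e (i + 1)))
      (v := min (D.lawRCF (G z)) (vs (D.prospect (e ⟨i, by omega⟩)))) hT hC hvs he).2
      ⟨hz, by rw [EReal.coe_strictMono.monotone.map_min]; exact lt_min hl (hi ▸ hlt),
        by rw [hk, hi]; exact EReal.coe_le_coe_iff.2 (min_le_right _ _), min_le_left _ _⟩
    exact ⟨x, hx⟩

/-- `hub` makes the upper bound on `v` harmless, and `hex` puts the value of any maximizer above the
strict lower bound; attainment is not assumed. -/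
theorem optimalG_iff (hT : 1 ≤ T) (hC : 0 < D.C) {Z : Set (Fin M → ℝ)}
    {G : (Fin M → ℝ) → Prospect T N} {vs : Prospect T N → ℝ} (hvs : D.IsValueSolution vs)
    {e : Fin (2 * K + 1) ≃ Label K} (he : D.IsDecomposition vs e) {j : ℕ}
    (hub : ∀ z ∈ Z, (D.lawRCF (G z) : EReal) ≤ D.level vs e j)
    (hex : ∃ z ∈ Z, D.level vs e (j + 1) < (D.lawRCF (G z) : EReal)) (z : Fin M → ℝ) (v : ℝ) :
    D.OptimalG Z G vs e j (z, v) ↔ D.IsPROSolution Z G z ∧ v = D.lawRCF (G z) := by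
  constructor
  · rintro ⟨x, hx, hmax, hr⟩
    obtain ⟨rfl, rfl⟩ := Prod.mk.inj hr
    obtain ⟨hz, hl, -, hv⟩ := (mem_levelSet_image_iff hT hC hvs he).1 ⟨x, hx, rfl, rfl⟩
    have hall : ∀ z' ∈ Z, D.lawRCF (G z') ≤ x.2.1 := fun z' hz' => by
      rcases lt_or_ge (D.level vs e (j + 1)) (D.lawRCF (G z') : EReal) with h | h
      · obtain ⟨y, hy, -, hyv⟩ := (mem_levelSet_image_iff hT hC hvs he).2
          ⟨hz', h, hub z' hz', le_rfl⟩
        exact hyv ▸ hmax y hy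
      · exact EReal.coe_le_coe_iff.1 (h.trans hl.le)
    exact ⟨⟨hz, fun z' hz' => (hall z' hz').trans hv⟩, le_antisymm hv (hall _ hz)⟩
  · rintro ⟨⟨hz, hmax⟩, rfl⟩
    obtain ⟨z', hz', hlt⟩ := hex
    obtain ⟨x, hx, rfl, hxv⟩ := (mem_levelSet_image_iff hT hC hvs he).2
      ⟨hz, hlt.trans_le (EReal.coe_le_coe_iff.2 (hmax z' hz')), hub z hz, le_rfl⟩
    refine ⟨x, hx, fun y hy => ?_, by rw [hxv]⟩
    obtain ⟨hy1, -, -, hyv⟩ := (mem_levelSet_image_iff hT hC hvs he).1 ⟨y, hy, rfl, rfl⟩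
    exact hyv.trans ((hmax _ hy1).trans hxv.ge)

/-- The runs of the binary search over the levels. -/
theorem exists_runs_levelSearch_iff (hT : 1 ≤ T) (hC : 0 < D.C) {Z : Set (Fin M → ℝ)}
    (hZ : Z.Nonempty) {G : (Fin M → ℝ) → Prospect T N} {vs : Prospect T N → ℝ}
    (hvs : D.IsValueSolution vs) {e : Fin (2 * K + 1) ≃ Label K} (he : D.IsDecomposition vs e) :
    ∃ a ≤ Nat.log 2 (2 * K + 1) + 1, ∀ a' b z v,
      Runs (D.FeasibleF Z G vs e) (D.OptimalG Z G vs e) (D.levelSearch M vs e) a' b (z, v) ↔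
        a' = a ∧ b = 1 ∧ D.IsPROSolution Z G z ∧ v = D.lawRCF (G z) := by
  let sel : ℕ → ℕ := fun h => D.kappa vs e (D.level vs e h)
  obtain ⟨a, h, -, hJ, hU, hL, ha, hr⟩ := exists_runs_bisection_iff
    (F := D.FeasibleF Z G vs e) (O := D.OptimalG Z G vs e) (sel := sel)
    (U := fun h => h = 2 * K + 2 ∨ D.FeasibleF Z G vs e (sel h))
    (L := fun h => h = 0 ∨ ¬D.FeasibleF Z G vs e (sel h)) (fun _ => Or.inr) (fun _ => Or.inr)
    (2 * K + 2) 0 (by omega) (Or.inl rfl) (Or.inl rfl)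
  -- The level after the last one is `⊥`, so index `J` is always feasible and the search never ends
  -- at the untested `J + 1`.
  have hlast : D.FeasibleF Z G vs e (sel (2 * K + 1)) := by
    obtain ⟨z, hz⟩ := hZ
    refine (feasibleF_kappa_iff hT hC hvs he (by omega) le_rfl).2 ⟨z, hz, ?_⟩
    have := (kappa_spec he (show 1 ≤ 2 * K + 1 by omega) le_rfl).1
    rw [level_eq_bot (by omega)]
    exact EReal.bot_lt_coe _
  have hhJ : h + 1 ≤ 2 * K + 1 := by
    by_contra hn
    obtain rfl : h = 2 * K + 1 := by omega
    exact hL.elim (by omega) fun hF => hF hlast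
  have hF : D.FeasibleF Z G vs e (sel (h + 1)) := hU.resolve_left (by omega)
  -- For `h = 0` the bound is the largest value of ψ on Θ. Otherwise infeasibility at `h` bounds ψ∘G
  -- by the level at `κ(h) + 1`, which is no higher than that of `h + 1` since `κ(h) ≥ h`.
  have hub : ∀ z ∈ Z, (D.lawRCF (G z) : EReal) ≤ D.level vs e (sel (h + 1)) := fun z hz => by
    rw [(kappa_spec he (show 1 ≤ h + 1 by omega) hhJ).2.1]
    rcases Nat.eq_zero_or_pos h with rfl | hpos
    · have h0 := level_succ (D := D) vs e 0
      rw [Fin.val_zero] at h0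
      rw [h0, EReal.coe_le_coe_iff]
      refine lawRCF_le_of_forall hT (hvs.nonempty hT hC) (fun l => ?_) _
      rw [← hvs.eq_lawRCF hT hC (prospect_mem_thetaL l)]
      obtain ⟨i, rfl⟩ := e.surjective l
      exact he (Fin.zero_le i)
    · have hn := hL.resolve_left hpos.ne'
      rw [feasibleF_kappa_iff hT hC hvs he hpos (by omega)] at hn
      push Not at hn
      exact (hn z hz).trans (he.level_anti (by omega)
        (Nat.succ_le_succ (kappa_spec he hpos (by omega)).1))
  refine ⟨a, ha.trans (clog_two_succ_le _), fun a' b z v => ?_⟩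
  rw [levelSearch, hr a' b (z, v), optimalG_iff hT hC hvs he hub
    ((feasibleF_kappa_iff hT hC hvs he (by omega) hhJ).1 hF)]

/-! ### Attainment and convexity -/

/-- Near `z` all coordinates of `G` rise by less than a prescribed constant `c`, and by monotonicity
and the Lipschitz bound ψ then rises by at most `C * c`. -/
theorem upperSemicontinuousOn_lawRCF (hT : 1 ≤ T) (hC : 0 < D.C)
    (hne : D.lawAmbiguitySet.Nonempty) {Z : Set (Fin M → ℝ)} {G : (Fin M → ℝ) → Prospect T N}
    (hG : ∀ t n, UpperSemicontinuousOn (fun z => G z t n) Z) :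
    UpperSemicontinuousOn (fun z => D.lawRCF (G z)) Z := by
  intro z hz y hy
  have hψ := ((mem_lawAmbiguitySet_iff hT).1 (lawRCF_mem hT hne)).1
  obtain ⟨r, hr, hry⟩ := exists_between hy
  have hpos : 0 < (r - D.lawRCF (G z)) / D.C := div_pos (sub_pos.2 hr) hC
  have hev : ∀ᶠ z' in nhdsWithin z Z, ∀ t n,
      G z' t n < G z t n + (r - D.lawRCF (G z)) / D.C :=
    Filter.eventually_all.2 fun t => Filter.eventually_all.2 fun n =>
      hG t n z hz _ (lt_add_of_pos_right _ hpos)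
  filter_upwards [hev] with z' hz'
  have h1 : D.lawRCF (G z') ≤
      D.lawRCF (G z + const T N ((r - D.lawRCF (G z)) / D.C)) :=
    hψ.mono fun t n => (hz' t n).le
  have h2 := hψ.le_add_const hC.le (G z + const T N ((r - D.lawRCF (G z)) / D.C))
    (-((r - D.lawRCF (G z)) / D.C))
  rw [abs_neg, abs_of_pos hpos, mul_div_cancel₀ _ hC.ne', add_assoc] at h2
  have h3 : const T N ((r - D.lawRCF (G z)) / D.C) +
      const T N (-((r - D.lawRCF (G z)) / D.C)) = 0 := by
    ext t n
    exact add_neg_cancel _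
  rw [h3, add_zero] at h2
  linarith

theorem exists_isPROSolution (hT : 1 ≤ T) (hC : 0 < D.C)
    (hne : D.lawAmbiguitySet.Nonempty) {Z : Set (Fin M → ℝ)} (hZne : Z.Nonempty)
    (hZ : IsCompact Z) {G : (Fin M → ℝ) → Prospect T N}
    (hG : ∀ t n, UpperSemicontinuousOn (fun z => G z t n) Z) : ∃ z, D.IsPROSolution Z G z :=
  (upperSemicontinuousOn_lawRCF hT hC hne hG).exists_isMaxOn hZne hZ

/-- Beyond linear constraints there are only `z ∈ Z`, an interval for `v`, and the reward
constraint, where `G` enters with a minus sign and concavity suffices. -/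
theorem convex_levelSet {Z : Set (Fin M → ℝ)} {G : (Fin M → ℝ) → Prospect T N}
    (hG : ConcaveOn ℝ Z G) (vs : Prospect T N → ℝ) (e : Fin (2 * K + 1) ≃ Label K) (j : ℕ) :
    Convex ℝ (D.levelSet Z G vs e j) := by
  rintro ⟨z, v, p, q, ρ⟩ ⟨hz, hl, hu, hv, hρG, hp1, hp0, hq, hρ⟩ ⟨z', v', p', q', ρ'⟩
    ⟨hz', hl', hu', hv', hρG', hp1', hp0', hq', hρ'⟩ a b ha hb hab
  dsimp only at *
  have hlv : D.level vs e (j + 1) < ((a * v + b * v' : ℝ) : EReal) ∧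
      ((a * v + b * v' : ℝ) : EReal) ≤ D.level vs e j := by
    have hmin : min v v' ≤ a * v + b * v' := Convex.min_le_combo v v' ha hb hab
    have hmax : a * v + b * v' ≤ max v v' := Convex.combo_le_max v v' ha hb hab
    constructor
    · refine lt_of_lt_of_le ?_ (EReal.coe_le_coe_iff.2 hmin)
      rcases min_choice v v' with h | h <;> rw [h] <;> assumption
    · refine (EReal.coe_le_coe_iff.2 hmax).trans ?_
      rcases max_choice v v' with h | h <;> rw [h] <;> assumption
  refine ⟨hG.1 hz hz' ha hb hab, hlv.1, hlv.2, ?_, fun n t => ?_, ?_, fun i => ?_, ?_,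
    fun i => ⟨?_, ?_, fun t t' => ?_⟩⟩
  · have h1 := mul_le_mul_of_nonneg_left hv ha
    have h2 := mul_le_mul_of_nonneg_left hv' hb
    simp only [Prod.smul_mk, Prod.mk_add_mk, Pi.add_apply, Pi.smul_apply, smul_eq_mul, mul_add,
      Finset.sum_add_distrib, mul_left_comm _ a, mul_left_comm _ b, ← Finset.mul_sum]
    linarith
  · have h1 := mul_le_mul_of_nonneg_left (hρG n t) ha
    have h2 := mul_le_mul_of_nonneg_left (hρG' n t) hb
    have h3 : a * G z t n + b * G z' t n ≤ G (a • z + b • z') t n :=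
      hG.2 hz hz' ha hb hab t n
    simp only [Prod.smul_mk, Prod.mk_add_mk, Pi.add_apply, Pi.smul_apply, smul_eq_mul,
      Matrix.transpose_add, Matrix.transpose_smul, Matrix.add_mulVec, Matrix.smul_mulVec,
      Finset.sum_add_distrib, ← Finset.mul_sum]
    linarith
  · simp only [Prod.smul_mk, Prod.mk_add_mk, Pi.add_apply, Pi.smul_apply, smul_eq_mul,
      Finset.sum_add_distrib, ← Finset.mul_sum, hp1, hp1', mul_one, hab]
  · exact add_nonneg (mul_nonneg ha (hp0 i)) (mul_nonneg hb (hp0' i))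
  · exact add_nonneg (mul_nonneg ha hq) (mul_nonneg hb hq')
  · simp only [Prod.smul_mk, Prod.mk_add_mk, Pi.add_apply, Pi.smul_apply, Matrix.vecMul_add,
      Matrix.vecMul_smul, (hρ i).1, (hρ' i).1]
    rfl
  · simp only [Prod.smul_mk, Prod.mk_add_mk, Pi.add_apply, Pi.smul_apply, Matrix.add_mulVec,
      Matrix.smul_mulVec, (hρ i).2.1, (hρ' i).2.1]
    rfl
  · exact add_nonneg (mul_nonneg ha ((hρ i).2.2 t t')) (mul_nonneg hb ((hρ' i).2.2 t t'))

end Model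
end PRO

theorem mainTheorem11 {T N K M : ℕ} (hT : 1 ≤ T) (hN : 1 ≤ N)
    (D : PRO.Model T N K) (hC : 0 < D.C)
    (Z : Set (Fin M → ℝ)) (hZne : Z.Nonempty) (hZcomp : IsCompact Z) (hZconv : Convex ℝ Z)
    (G : (Fin M → ℝ) → PRO.Prospect T N) (hG : ConcaveOn ℝ Z G)
    (vs : PRO.Prospect T N → ℝ) (hvs : D.IsValueSolution vs)
    (e : Fin (2 * K + 1) ≃ PRO.Label K) (he : D.IsDecomposition vs e) :
    -- every run outputs an optimal solution and its value, within the stated number of calls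
    (∀ (a b : ℕ) (z : Fin M → ℝ) (v : ℝ),
      PRO.Runs (D.FeasibleF Z G vs e) (D.OptimalG Z G vs e) (D.levelSearch M vs e) a b (z, v) →
        D.IsPROSolution Z G z ∧ v = D.lawRCF (G z) ∧ a ≤ Nat.log 2 (2 * K + 1) + 1 ∧ b = 1) ∧
    -- every optimal solution is the output of a run
    (∀ z, D.IsPROSolution Z G z →
      ∃ (a b : ℕ) (v : ℝ),
        PRO.Runs (D.FeasibleF Z G vs e) (D.OptimalG Z G vs e) (D.levelSearch M vs e) a b (z, v)) ∧
    -- if the rewards are upper semicontinuous on `Z`, there is a run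
    ((∀ t n, UpperSemicontinuousOn (fun z => G z t n) Z) →
      ∃ (a b : ℕ) (z : Fin M → ℝ) (v : ℝ),
        PRO.Runs (D.FeasibleF Z G vs e) (D.OptimalG Z G vs e) (D.levelSearch M vs e) a b (z, v)) ∧
    -- the problems that are solved are convex
    (∀ j, Convex ℝ (D.levelSet Z G vs e j)) := by
  obtain ⟨a₀, ha₀, hruns⟩ :=
    PRO.Model.exists_runs_levelSearch_iff (G := G) hT hC hZne hvs he
  refine ⟨fun a b z v h => ?_, fun z hz => ⟨a₀, 1, _, (hruns _ _ _ _).2 ⟨rfl, rfl, hz, rfl⟩⟩,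
    fun husc => ?_, fun j => PRO.Model.convex_levelSet hG vs e j⟩
  · obtain ⟨rfl, hb, hz, hv⟩ := (hruns a b z v).1 h
    exact ⟨hz, hv, ha₀, hb⟩
  · obtain ⟨z, hz⟩ := PRO.Model.exists_isPROSolution hT hC (hvs.nonempty hT hC) hZne hZcomp husc
    exact ⟨a₀, 1, z, _, (hruns _ _ _ _).2 ⟨rfl, rfl, hz, rfl⟩⟩
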